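/- Let $G=(V,E)$ be a vertex-transitive graph, finite or infinite, with countable vertex set (as is automatic for a connected locally finite graph), let $0\in V$ be an arbitrary vertex and let $p\in[0,1]$. In bond percolation on a graph, each edge is independently kept (open) with probability $p$ and deleted otherwise; let $\mathbf{P}_p$ be the resulting probability measure. Let $\mathcal{C}(0)$ be the set of vertices joined to $0$ by a path of open edges of $G$. For a subgraph $G'\subset G$ and an integer $r\ge 1$ let $H_p(r;G')$ be the event that, in percolation with parameter $p$ on $G'$, some vertex is at graph distance exactly $r$ from $0$ in the subgraph of open edges of $G'$ (this event is empty if $0\notin G'$), and put $$\Gamma_p(r)=\sup_{G'\subset G}\mathbf{P}\big(H_p(r;G')\big).$$ For every $C_1>0$ there is a constant $C_2=C_2(C_1)>0$, depending only on $C_1$, such that for all $G$, $0$ and $p$ as above the following holds. If $$\mathbf{P}_p\big(|\mathcal{C}(0)|\ge k\big)\le \frac{C_1}{\sqrt{k}}\qquad\text{for all integers } k\ge 1,$$ then $$\Gamma_p(r)\le \frac{C_2}{r}\qquad\text{for all integers } r\ge 1.$$ -/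

import Mathlib

namespace BondPercolation

open MeasureTheory ProbabilityTheory
open scoped ENNReal

/-- A graph is (vertex-)transitive if its automorphism group acts transitively on the vertices. -/
def IsTransitive {V : Type*} (G : SimpleGraph V) : Prop :=
  ∀ x y : V, ∃ φ : G ≃g G, φ x = y

/-- Bond percolation on `G` with parameter `p`: the law of the random set of open edges, to which
each edge of `G` belongs independently with probability `p`. -/
noncomputable def percolation {V : Type*} (G : SimpleGraph V) (p : unitInterval) :
    Measure (Set (Sym2 V)) :=
  setBernoulli G.edgeSet p

/-- The percolated graph `G_p`: the subgraph of `G`, on all the vertices of `G`, whose edges are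
the open ones. -/
def openGraph {V : Type*} (G : SimpleGraph V) (ω : Set (Sym2 V)) : SimpleGraph V :=
  SimpleGraph.fromEdgeSet (G.edgeSet ∩ ω)

/-- The open cluster `C(x)`: the vertex set of the connected component of `x` in `G_p`. -/
def cluster {V : Type*} (G : SimpleGraph V) (ω : Set (Sym2 V)) (x : V) : Set V :=
  ((openGraph G ω).connectedComponentMk x).supp

/-- The sphere `∂B_p(x, r; G)` of the intrinsic metric: the vertices at distance exactly `r` from
`x` in `G_p`, where vertices that are not connected to `x` are at distance `⊤`. -/
def intrinsicSphere {V : Type*} (G : SimpleGraph V) (ω : Set (Sym2 V)) (x : V) (r : ℕ) : Set V :=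
  {u | (openGraph G ω).edist x u = r}

/-- The one-arm event `H_p(r; G)`: some vertex is at intrinsic distance exactly `r` from `x`. -/
def armEvent {V : Type*} (G : SimpleGraph V) (x : V) (r : ℕ) : Set (Set (Sym2 V)) :=
  {ω | (intrinsicSphere G ω x r).Nonempty}

/-- `Γ_p(r; G)`: the supremum over all subgraphs `G'` of `G` of the probability that `H_p(r; G')`
occurs in percolation on `G'`. The vertices of `G` that are not in `G'` are kept as isolated
vertices (`spanningCoe`); for `r ≥ 1` this does not affect the arm event, which has probability
zero when `x` is not in `G'`. -/
noncomputable def armProb {V : Type*} (G : SimpleGraph V) (p : unitInterval) (x : V) (r : ℕ) :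
    ℝ≥0∞ :=
  ⨆ G' : G.Subgraph, percolation G'.spanningCoe p (armEvent G'.spanningCoe x r)

end BondPercolation

/-!
The arm probability satisfies, for all `m` and `b`, the recursive inequality
`Γ(3m) ≤ P(|C(o)| ≥ m (b + 1)) + b Γ(m)²` (`armProb_three_mul_le`), which goes back to Kozma and
Nachmias. In a subgraph `H` of `G`, explore the open cluster of `o` sphere by sphere. If there is
an arm of length `3m` and the cluster has fewer than `m (b + 1)` vertices, then one of the `m`
disjoint spheres of radius `m, …, 2m - 1` has at most `b` vertices. Stop at the first such sphere.
What has been explored up to then depends only on the edges that meet the interior of the ball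
(`mem_historyEvent_of_inter_touching_eq`), while the rest of the arm is an arm of length at least
`m` which starts on the sphere and uses none of these edges. Since `Γ` is a supremum over *all*
subgraphs and `G` is transitive, the conditional probability of such an arm is at most `b Γ(m)`,
and the exploration reaches radius `m` with probability at most `Γ(m)`.

With `A = 1 + 216 C²` and `b = ⌊m / (6A)⌋`, the bound `Γ(m) ≤ A / m` gives
`Γ(3m) ≤ A / (3m)` (`recursion_bound`), so the bound holds along the powers of `3`, and by
monotonicity in the length it holds for all `r` with a further factor `3`.

Percolation on all subgraphs of `G` is realized on one space, that of a Bernoulli random set of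
unordered pairs of vertices. Restricting this set to the edges of `H` gives the percolation measure
of `H` (`setBernoulli_univ_map_inter`), its law is invariant under permutations
(`setBernoulli_univ_map_preimage`), and disjoint sets of pairs are independent
(`setBernoulli_univ_inter_eq_mul`). There are only countably many possible histories of the
exploration, so that no conditional measures are needed.
-/

/-! ### Bernoulli random sets -/

namespace ProbabilityTheory

open MeasureTheory Measure _root_.unitInterval

variable {ι : Type*}

/-- A Bernoulli random subset of the whole type, intersected with `u`, is a Bernoulli random subset
of `u`. This couples the random subsets of all sets `u`. -/
theorem setBernoulli_univ_map_inter (u : Set ι) (p : I) :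
    (setBernoulli Set.univ p).map (fun s ↦ s ∩ u) = setBernoulli u p := by
  classical
  have hf : ∀ i, Measurable (fun q : Prop ↦ q ∧ i ∈ u) := fun i ↦ .of_discrete
  have hm : Measurable fun s : Set ι ↦ s ∩ u := by
    rw [measurable_set_iff]
    intro i
    exact (hf i).comp (measurable_set_mem i)
  have hm' : Measurable fun q : ι → Prop ↦ {i | q i} := by
    rw [measurable_set_iff]
    intro i
    exact measurable_pi_apply i
  rw [setBernoulli_eq_map, setBernoulli_eq_map, Measure.map_map hm hm']
  have h1 : (fun i : ι ↦ toNNReal p • dirac (i ∈ u) + toNNReal (σ p) • dirac False)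
      = fun i : ι ↦ ((toNNReal p • dirac (i ∈ Set.univ) + toNNReal (σ p) • dirac False).map
          (fun q : Prop ↦ q ∧ i ∈ u)) := by
    funext i
    rw [Measure.map_add _ _ (hf i), Measure.map_smul, Measure.map_smul, map_dirac' (hf i),
      map_dirac' (hf i)]
    simp
  simp_rw [h1]
  rw [← infinitePi_map_pi _ hf, Measure.map_map hm' (by fun_prop)]
  rfl

theorem setBernoulli_univ_map_preimage (e : ι ≃ ι) (p : I) :
    (setBernoulli Set.univ p).map (fun s ↦ e ⁻¹' s) = setBernoulli Set.univ p := by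
  have hm : Measurable fun s : Set ι ↦ e ⁻¹' s := by
    rw [measurable_set_iff]
    intro i
    exact measurable_set_mem (e i)
  have hm' : Measurable fun q : ι → Prop ↦ {i | q i} := by
    rw [measurable_set_iff]
    intro i
    exact measurable_pi_apply i
  rw [setBernoulli_eq_map, Measure.map_map hm hm']
  have := infinitePi_map_piCongrLeft
    (μ := fun i : ι ↦ toNNReal p • dirac (i ∈ Set.univ) + toNNReal (σ p) • dirac False) e.symm
  conv_rhs => rw [← this]
  rw [Measure.map_map hm' (by fun_prop)]
  congr 1
  funext q
  ext i
  simp [MeasurableEquiv.coe_piCongrLeft, Equiv.piCongrLeft_apply]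

theorem iIndepFun_setBernoulli_univ (p : I) :
    iIndepFun (fun (i : ι) (s : Set ι) ↦ i ∈ s) (setBernoulli Set.univ p) := by
  have hm : Measurable fun q : ι → Prop ↦ {i | q i} := by
    rw [measurable_set_iff]
    intro i
    exact measurable_pi_apply i
  have hm' : Measurable fun (s : Set ι) (i : ι) ↦ i ∈ s :=
    measurable_pi_iff.2 measurable_set_mem
  rw [iIndepFun_iff_map_fun_eq_infinitePi_map measurable_set_mem]
  conv_lhs => rw [setBernoulli_eq_map, Measure.map_map hm' hm]
  conv_rhs =>
    enter [1, i]
    rw [setBernoulli_eq_map, Measure.map_map (measurable_set_mem i) hm]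
  have h1 : ∀ i, ((fun s : Set ι ↦ i ∈ s) ∘ fun q : ι → Prop ↦ {i | q i}) = fun q ↦ q i :=
    fun i ↦ rfl
  simp_rw [h1, infinitePi_map_eval]
  exact Measure.map_id

/-- Events that are determined by disjoint sets of coordinates are independent. -/
theorem setBernoulli_univ_inter_eq_mul (p : I) (F : Set ι) {A B : Set (Set ι)}
    (hA : MeasurableSet A) (hB : MeasurableSet B) (hAF : ∀ s, s ∩ F ∈ A ↔ s ∈ A)
    (hBF : ∀ s, s ∩ Fᶜ ∈ B ↔ s ∈ B) :
    setBernoulli Set.univ p (A ∩ B) = setBernoulli Set.univ p A * setBernoulli Set.univ p B := by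
  have key : ∀ (F : Set ι) {A : Set (Set ι)}, MeasurableSet A → (∀ s, s ∩ F ∈ A ↔ s ∈ A) →
      MeasurableSet[⨆ i ∈ F, MeasurableSpace.comap (fun s : Set ι ↦ i ∈ s) ⊤] A := by
    intro F A hA hAF
    have h : A = (fun s ↦ s ∩ F) ⁻¹' A := by ext s; exact (hAF s).symm
    rw [h]
    refine @measurableSet_preimage _ _ (_) _ _ _ ?_ hA
    refine (@measurable_set_iff _ _ (_) _).2 ?_
    intro i
    by_cases hi : i ∈ F
    · simp only [Set.mem_inter_iff, hi, and_true]
      exact (comap_measurable _).mono (le_iSup₂_of_le i hi le_rfl) le_rfl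
    · simp only [Set.mem_inter_iff, hi, and_false]
      exact measurable_const
  have hi := indep_iSup_of_disjoint (fun i ↦ (measurable_set_mem i).comap_le)
    ((iIndepFun_iff_iIndep _ _ _).1 (iIndepFun_setBernoulli_univ p)) (disjoint_compl_right (a := F))
  exact (Indep_iff _ _ _).1 hi _ _ (key F hA hAF) (key Fᶜ hB hBF)

end ProbabilityTheory

/-! ### Spheres of the graph distance -/

namespace SimpleGraph

variable {V : Type*} {K : SimpleGraph V} {x y z u v : V}

theorem edist_eq_add_one_iff {n : ℕ} :
    K.edist x v = (n + 1 : ℕ) ↔ (∀ l ≤ n, K.edist x v ≠ l) ∧ ∃ u, K.edist x u = n ∧ K.Adj u v := by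
  constructor
  · intro h
    refine ⟨fun l hl h' ↦ ?_, ?_⟩
    · rw [h] at h'
      have : n + 1 = l := by exact_mod_cast h'
      omega
    · obtain ⟨w, hw⟩ := exists_walk_of_edist_eq_coe h
      have hnil : ¬ w.Nil := by
        intro hn
        have := Walk.length_eq_zero_iff.2 hn
        omega
      refine ⟨w.penultimate, le_antisymm ?_ ?_, w.adj_penultimate hnil⟩
      · refine (edist_le w.dropLast).trans ?_
        have : w.dropLast.length = n := by simp [hw]
        rw [this]
      · have h1 := K.edist_triangle (u := x) (v := w.penultimate) (w := v)
        rw [h, edist_eq_one_iff_adj.2 (w.adj_penultimate hnil)] at h1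
        push_cast at h1
        exact (ENat.add_le_add_iff_right ENat.one_ne_top).1 h1
  · rintro ⟨h, u, hu, huv⟩
    have h1 : K.edist x v ≤ (n + 1 : ℕ) := by
      have h1 := K.edist_triangle (u := x) (v := u) (w := v)
      rwa [hu, edist_eq_one_iff_adj.2 huv] at h1
    obtain ⟨l, hl⟩ := ENat.ne_top_iff_exists.1 (ne_top_of_le_ne_top (ENat.natCast_ne_top _) h1)
    rw [← hl] at h1 ⊢
    have h2 : l ≤ n + 1 := by exact_mod_cast h1
    have h3 : ¬ l ≤ n := fun hln ↦ h l hln hl.symm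
    have : l = n + 1 := by omega
    rw [this]

/-- A geodesic from `x` to a vertex at distance `j + m` stays at distance at least `j` from `x`
after its first `j` steps; its last `m` steps form a geodesic of any subgraph `K'` which contains
the edges of `K` with both ends at distance at least `j`. -/
theorem exists_edist_eq_of_edist_eq_add {K' : SimpleGraph V} {j : ℕ} (hle : K' ≤ K)
    (hK' : ∀ u v, K.Adj u v → j ≤ K.edist x u → j ≤ K.edist x v → K'.Adj u v) :
    ∀ {m : ℕ} {z : V}, K.edist x z = (j + m : ℕ) → ∃ y, K.edist x y = j ∧ K'.edist y z = m := by
  have key : ∀ (m : ℕ) (z : V), K.edist x z = (j + m : ℕ) →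
      ∃ y, K.edist x y = j ∧ K'.edist y z ≤ m := by
    intro m
    induction m with
    | zero => exact fun z hz ↦ ⟨z, hz, by simp⟩
    | succ m ih =>
      intro z hz
      obtain ⟨-, u, hu, huz⟩ := edist_eq_add_one_iff.1 hz
      obtain ⟨y, hy, hyu⟩ := ih u hu
      refine ⟨y, hy, ?_⟩
      have h1 : K'.Adj u z := by
        refine hK' u z huz ?_ ?_
        · rw [hu]; exact_mod_cast Nat.le_add_right _ _
        · rw [hz]; exact_mod_cast Nat.le_add_right _ _
      refine (K'.edist_triangle (v := u)).trans ?_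
      rw [edist_eq_one_iff_adj.2 h1]
      push_cast
      gcongr
  intro m z hz
  obtain ⟨y, hy, hyz⟩ := key m z hz
  refine ⟨y, hy, le_antisymm hyz ?_⟩
  have h1 := K.edist_triangle (u := x) (v := y) (w := z)
  rw [hz, hy, Nat.cast_add] at h1
  exact ((ENat.add_le_add_iff_left (ENat.natCast_ne_top _)).1 h1).trans (edist_anti hle)

theorem exists_edist_eq_of_le {m n : ℕ} (hmn : m ≤ n) (h : ∃ z, K.edist x z = n) :
    ∃ z, K.edist x z = m := by
  obtain ⟨z, hz⟩ := h
  obtain ⟨k, rfl⟩ := Nat.exists_eq_add_of_le hmn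
  obtain ⟨y, hy, -⟩ := exists_edist_eq_of_edist_eq_add le_rfl (fun u v h _ _ ↦ h) hz
  exact ⟨y, hy⟩

theorem Iso.edist_map {W : Type*} {K' : SimpleGraph W} (φ : K ≃g K') (u v : V) :
    K'.edist (φ u) (φ v) = K.edist u v := by
  apply le_antisymm
  · by_cases h : K.edist u v = ⊤
    · simp [h]
    · obtain ⟨w, hw⟩ := exists_walk_of_edist_ne_top h
      rw [← hw, ← Walk.length_map φ.toHom w]
      exact edist_le _
  · by_cases h : K'.edist (φ u) (φ v) = ⊤
    · simp [h]
    · obtain ⟨w, hw⟩ := exists_walk_of_edist_ne_top h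
      rw [← hw, ← Walk.length_map φ.symm.toHom w]
      have := edist_le (w.map φ.symm.toHom)
      simpa using this

end SimpleGraph

/-! ### The arm event in coupled percolation on all subgraphs -/

namespace BondPercolation

open MeasureTheory ProbabilityTheory
open scoped ENNReal

variable {V : Type*} {G H : SimpleGraph V} {ω ω' : Set (Sym2 V)} {x y u v : V}

theorem openGraph_adj : (openGraph H ω).Adj u v ↔ H.Adj u v ∧ s(u, v) ∈ ω := by
  simp only [openGraph, SimpleGraph.fromEdgeSet_adj, Set.mem_inter_iff, SimpleGraph.mem_edgeSet]
  exact ⟨fun h ↦ h.1, fun h ↦ ⟨h, h.1.ne⟩⟩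

theorem openGraph_inter_edgeSet : openGraph H (ω ∩ H.edgeSet) = openGraph H ω := by
  ext u v
  simp [openGraph_adj]
  tauto

theorem openGraph_mono (h : H ≤ G) : openGraph H ω ≤ openGraph G ω := by
  intro u v huv
  rw [openGraph_adj] at huv ⊢
  exact ⟨h huv.1, huv.2⟩

theorem mem_armEvent {r : ℕ} : ω ∈ armEvent H x r ↔ ∃ u, (openGraph H ω).edist x u = r := Iff.rfl

theorem armEvent_anti {m n : ℕ} (h : m ≤ n) : armEvent H x n ⊆ armEvent H x m :=
  fun _ hω ↦ SimpleGraph.exists_edist_eq_of_le h hω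

theorem measurable_edist_eq [Countable V] (H : SimpleGraph V) (x : V) (n : ℕ) :
    ∀ v, Measurable fun ω ↦ (openGraph H ω).edist x v = n := by
  induction n using Nat.strong_induction_on with
  | _ n ih =>
    intro v
    cases n with
    | zero => simp
    | succ n =>
      simp_rw [SimpleGraph.edist_eq_add_one_iff, openGraph_adj]
      refine .and (.forall fun l ↦ ?_) (.exists fun u ↦ (ih n (by omega) u).and
        (measurable_const.and (measurable_set_mem _)))
      by_cases hl : l ≤ n
      · simpa [hl] using (ih l (by omega) v).not
      · simp [hl]

theorem measurableSet_armEvent [Countable V] (H : SimpleGraph V) (x : V) (r : ℕ) :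
    MeasurableSet (armEvent H x r) :=
  measurableSet_setOfPred.2 (.exists fun v ↦ measurable_edist_eq H x r v)

theorem percolation_eq_map (H : SimpleGraph V) (p : unitInterval) :
    percolation H p = (setBernoulli Set.univ p).map (fun ω ↦ ω ∩ H.edgeSet) :=
  (setBernoulli_univ_map_inter _ p).symm

theorem measurable_inter_const {ι : Type*} (F : Set ι) : Measurable fun s : Set ι ↦ s ∩ F := by
  rw [measurable_set_iff]
  intro i
  exact (measurable_set_mem i).and measurable_const

theorem percolation_armEvent [Countable V] (H : SimpleGraph V) (p : unitInterval) (x : V) (r : ℕ) :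
    percolation H p (armEvent H x r) = setBernoulli Set.univ p (armEvent H x r) := by
  rw [percolation_eq_map, Measure.map_apply (measurable_inter_const _)
    (measurableSet_armEvent H x r)]
  congr 1
  ext ω
  simp only [Set.mem_preimage, mem_armEvent, openGraph_inter_edgeSet]

theorem setBernoulli_armEvent_le_armProb_self [Countable V] (h : H ≤ G) (p : unitInterval) (x : V)
    (r : ℕ) : setBernoulli Set.univ p (armEvent H x r) ≤ armProb G p x r := by
  have h1 := le_iSup (fun G' : G.Subgraph ↦
    percolation G'.spanningCoe p (armEvent G'.spanningCoe x r)) (SimpleGraph.toSubgraph H h)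
  rw [← percolation_armEvent]
  exact h1

theorem armProb_le_iff [Countable V] {p : unitInterval} {r : ℕ} {c : ℝ≥0∞} :
    armProb G p x r ≤ c ↔ ∀ H ≤ G, setBernoulli Set.univ p (armEvent H x r) ≤ c := by
  constructor
  · exact fun h H hH ↦ (setBernoulli_armEvent_le_armProb_self hH p x r).trans h
  · refine fun h ↦ iSup_le fun G' ↦ ?_
    rw [percolation_armEvent]
    exact h _ G'.spanningCoe_le

theorem armProb_le_one [Countable V] {p : unitInterval} {r : ℕ} : armProb G p x r ≤ 1 :=
  armProb_le_iff.2 fun _ _ ↦ prob_le_one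

theorem armProb_anti [Countable V] {p : unitInterval} {m n : ℕ} (h : m ≤ n) :
    armProb G p x n ≤ armProb G p x m :=
  armProb_le_iff.2 fun _ hH ↦ (measure_mono (armEvent_anti h)).trans
    (setBernoulli_armEvent_le_armProb_self hH p x m)

/-- By transitivity, the arm probabilities from any vertex are bounded by those from `x`:
an automorphism of `G` permutes its subgraphs and preserves the law of the open edges. -/
theorem setBernoulli_armEvent_le_armProb [Countable V] (hG : IsTransitive G) (h : H ≤ G)
    (p : unitInterval) (x y : V) (r : ℕ) :
    setBernoulli Set.univ p (armEvent H y r) ≤ armProb G p x r := by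
  obtain ⟨φ, rfl⟩ := hG x y
  have hle : H.comap φ ≤ G := fun u v huv ↦ φ.map_rel_iff.1 (h huv)
  refine le_trans (le_of_eq ?_) (setBernoulli_armEvent_le_armProb_self hle p x r)
  let e : Sym2 V ≃ Sym2 V :=
    { toFun := Sym2.map φ
      invFun := Sym2.map φ.symm
      left_inv := fun a ↦ by simp [Sym2.map_map]
      right_inv := fun a ↦ by simp [Sym2.map_map] }
  have hm : Measurable fun s : Set (Sym2 V) ↦ e ⁻¹' s := by
    rw [measurable_set_iff]
    intro i
    exact measurable_set_mem _
  conv_rhs => rw [← setBernoulli_univ_map_preimage e p]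
  rw [Measure.map_apply hm (measurableSet_armEvent _ _ _)]
  congr 1
  ext ω
  let ψ : openGraph (H.comap φ) (e ⁻¹' ω) ≃g openGraph H ω :=
    { φ.toEquiv with
      map_rel_iff' := by
        intro u v
        simp only [openGraph_adj, SimpleGraph.comap_adj]
        rfl }
  simp only [Set.mem_preimage, mem_armEvent]
  rw [← φ.toEquiv.exists_congr_right]
  refine exists_congr fun u ↦ ?_
  rw [← ψ.edist_map]
  rfl

theorem cluster_eq (H : SimpleGraph V) (ω : Set (Sym2 V)) (x : V) :
    cluster H ω x = {v | (openGraph H ω).Reachable x v} := by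
  ext v
  simp only [cluster, SimpleGraph.ConnectedComponent.mem_supp_iff, SimpleGraph.ConnectedComponent.eq,
    Set.mem_ofPred_eq]
  exact ⟨fun h ↦ h.symm, fun h ↦ h.symm⟩

theorem setBernoulli_le_encard_cluster_le (h : H ≤ G) (p : unitInterval) (x : V) (k : ℕ) :
    setBernoulli Set.univ p {ω | (k : ℕ∞) ≤ (cluster H ω x).encard} ≤
      percolation G p {ω | (k : ℕ∞) ≤ (cluster G ω x).encard} := by
  rw [percolation_eq_map]
  refine le_trans (measure_mono fun ω hω ↦ ?_)
    (Measure.le_map_apply (measurable_inter_const _).aemeasurable _)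
  simp only [Set.mem_preimage, Set.mem_ofPred_eq, cluster_eq, openGraph_inter_edgeSet] at hω ⊢
  exact hω.trans (Set.encard_le_encard fun v hv ↦ hv.mono (openGraph_mono h))

theorem intrinsicSphere_subset_cluster {r : ℕ} : intrinsicSphere H ω x r ⊆ cluster H ω x := by
  rw [cluster_eq]
  intro v hv
  have hv' : (openGraph H ω).edist x v = r := hv
  refine SimpleGraph.reachable_of_edist_ne_top ?_
  rw [hv']
  exact ENat.natCast_ne_top _

theorem pairwise_disjoint_intrinsicSphere :
    Pairwise (Function.onFun Disjoint (intrinsicSphere H ω x)) := by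
  intro i j hij
  refine Set.disjoint_left.2 fun v hi hj ↦ hij ?_
  have hi' : (openGraph H ω).edist x v = i := hi
  have hj' : (openGraph H ω).edist x v = j := hj
  exact_mod_cast hi'.symm.trans hj'

end BondPercolation

/-! ### Exploring the cluster up to its first small sphere -/

namespace BondPercolation

open MeasureTheory ProbabilityTheory
open scoped ENNReal

variable {V : Type*} {G H : SimpleGraph V} {ω ω' : Set (Sym2 V)} {x y u v : V}

/-- The subgraph of `H` of the edges with no end in `A`. -/
def avoid (H : SimpleGraph V) (A : Set V) : SimpleGraph V where
  Adj u v := H.Adj u v ∧ u ∉ A ∧ v ∉ A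
  symm := ⟨fun _ _ h ↦ ⟨h.1.symm, h.2.2, h.2.1⟩⟩
  loopless := ⟨fun _ h ↦ h.1.ne rfl⟩

/-- The unordered pairs that meet `A`. -/
def touching (A : Set V) : Set (Sym2 V) := {e | ∃ v ∈ A, v ∈ e}

theorem avoid_le (H : SimpleGraph V) (A : Set V) : avoid H A ≤ H := fun _ _ h ↦ h.1

theorem openGraph_avoid_inter (A : Set V) :
    openGraph (avoid H A) (ω ∩ (touching A)ᶜ) = openGraph (avoid H A) ω := by
  ext u v
  simp only [openGraph_adj, avoid, touching, Set.mem_inter_iff, Set.mem_compl_iff,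
    Set.mem_ofPred_eq, Sym2.mem_iff]
  constructor
  · exact fun h ↦ ⟨h.1, h.2.1⟩
  · rintro ⟨⟨h, hu, hv⟩, huv⟩
    refine ⟨⟨h, hu, hv⟩, huv, ?_⟩
    rintro ⟨w, hw, rfl | rfl⟩ <;> contradiction

/-- The event that the spheres of radius `0, …, j` in the open subgraph are the given sets. -/
def historyEvent (H : SimpleGraph V) (x : V) {j : ℕ} (s : Fin (j + 1) → Finset V) :
    Set (Set (Sym2 V)) :=
  {ω | ∀ i : Fin (j + 1), intrinsicSphere H ω x i = s i}

/-- The vertices of all but the last of the given sets. -/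
def interiorOf {j : ℕ} (s : Fin (j + 1) → Finset V) : Set V := {v | ∃ i : Fin j, v ∈ s i.castSucc}

theorem measurableSet_historyEvent [Countable V] (H : SimpleGraph V) (x : V) {j : ℕ}
    (s : Fin (j + 1) → Finset V) : MeasurableSet (historyEvent H x s) := by
  simp only [historyEvent, Set.ext_iff]
  exact measurableSet_setOfPred.2 (.forall fun i ↦ .forall fun v ↦
    (measurable_edist_eq H x i v).iff measurable_const)

theorem intrinsicSphere_zero : intrinsicSphere H ω x 0 = {x} := by
  ext v
  simp [intrinsicSphere, eq_comm (a := v)]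

theorem mem_intrinsicSphere_succ {n : ℕ} : v ∈ intrinsicSphere H ω x (n + 1) ↔
    (∀ l ≤ n, v ∉ intrinsicSphere H ω x l) ∧
      ∃ u ∈ intrinsicSphere H ω x n, (openGraph H ω).Adj u v :=
  SimpleGraph.edist_eq_add_one_iff

/-- The spheres up to radius `j` are found by inspecting the edges that meet one of the first
`j` of them. -/
theorem mem_historyEvent_of_inter_touching_eq {j : ℕ} {s : Fin (j + 1) → Finset V}
    (h : ω ∩ touching (interiorOf s) = ω' ∩ touching (interiorOf s))
    (hω : ω ∈ historyEvent H x s) : ω' ∈ historyEvent H x s := by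
  have key : ∀ i ≤ j, intrinsicSphere H ω' x i = intrinsicSphere H ω x i := by
    intro i
    induction i using Nat.strong_induction_on with
    | _ i ih =>
      intro hij
      cases i with
      | zero => simp [intrinsicSphere_zero]
      | succ i =>
        ext v
        rw [mem_intrinsicSphere_succ, mem_intrinsicSphere_succ, ih i (by omega) (by omega)]
        refine and_congr (forall₂_congr fun l hl ↦ ?_) (exists_congr fun u ↦
          and_congr_right fun hu ↦ ?_)
        · rw [ih l (by omega) (by omega)]
        · rw [openGraph_adj, openGraph_adj]
          refine and_congr_right fun _ ↦ ?_
          have hu' : u ∈ s (Fin.castSucc ⟨i, by omega⟩) := by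
            rw [← Finset.mem_coe, ← hω]
            exact hu
          have ht : s(u, v) ∈ touching (interiorOf s) := ⟨u, ⟨_, hu'⟩, Sym2.mem_mk_left u v⟩
          have := congrArg (s(u, v) ∈ ·) h
          simpa [ht] using this.symm
  intro i
  rw [key i (by omega)]
  exact hω i

/-- Given the spheres up to radius `j`, arms from the `j`-th one that avoid the interior live on
edges not inspected yet. -/
theorem setBernoulli_historyEvent_inter [Countable V] (H : SimpleGraph V) (p : unitInterval)
    (x : V) (m : ℕ) {j : ℕ} (s : Fin (j + 1) → Finset V) :
    setBernoulli Set.univ p (historyEvent H x s ∩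
      ⋃ y ∈ s (Fin.last j), armEvent (avoid H (interiorOf s)) y m) =
    setBernoulli Set.univ p (historyEvent H x s) *
      setBernoulli Set.univ p (⋃ y ∈ s (Fin.last j), armEvent (avoid H (interiorOf s)) y m) := by
  refine setBernoulli_univ_inter_eq_mul p (touching (interiorOf s))
    (measurableSet_historyEvent H x s)
    (Finset.measurableSet_biUnion _ fun y _ ↦ measurableSet_armEvent _ y m) (fun ω ↦ ?_) fun ω ↦ ?_
  · exact ⟨mem_historyEvent_of_inter_touching_eq (by simp [Set.inter_assoc]),
      mem_historyEvent_of_inter_touching_eq (by simp [Set.inter_assoc])⟩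
  · simp only [Set.mem_iUnion, mem_armEvent, openGraph_avoid_inter]

/-- A history of radius at least `m` is stopped if its last set is its first one from radius `m`
on with at most `b` elements. Empty last sets are excluded. -/
def IsStopped (m b : ℕ) {j : ℕ} (s : Fin (j + 1) → Finset V) : Prop :=
  m ≤ j ∧ (∀ i : Fin j, m ≤ i → b < (s i.castSucc).card) ∧ (s (Fin.last j)).card ≤ b ∧
    (s (Fin.last j)).Nonempty

theorem IsStopped.le_of_mem {m b j j' : ℕ} {s : Fin (j + 1) → Finset V}
    {s' : Fin (j' + 1) → Finset V} (hs : IsStopped m b s) (hs' : IsStopped m b s')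
    (h : ω ∈ historyEvent H x s) (h' : ω ∈ historyEvent H x s') : j' ≤ j := by
  by_contra! hlt
  have h1 := hs'.2.1 ⟨j, hlt⟩ hs.1
  have h2 : s (Fin.last j) = s' (Fin.castSucc ⟨j, hlt⟩) :=
    Finset.coe_injective ((h (Fin.last j)).symm.trans (h' (Fin.castSucc ⟨j, hlt⟩)))
  rw [← h2] at h1
  exact absurd hs.2.2.1 (by omega)

/-- A configuration has at most one stopped history, since the radius at which the exploration
stops is determined by the spheres. -/
theorem pairwise_disjoint_historyEvent (H : SimpleGraph V) (x : V) (m b : ℕ) :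
    Pairwise (Function.onFun Disjoint
      fun t : {t : Σ j : ℕ, Fin (j + 1) → Finset V // IsStopped m b t.2} ↦
        historyEvent H x t.1.2) := by
  rintro ⟨⟨j, s⟩, hs⟩ ⟨⟨j', s'⟩, hs'⟩ hne
  refine Set.disjoint_left.2 fun ω h h' ↦ hne ?_
  obtain rfl : j = j' := le_antisymm (hs'.le_of_mem hs h' h) (hs.le_of_mem hs' h h')
  obtain rfl : s = s' := by
    funext i
    exact Finset.coe_injective ((h i).symm.trans (h' i))
  rfl

/-- If there is an arm of length `3 * m`, then either the cluster is large or one of the spheres of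
radius `m, …, 2 * m - 1` has at most `b` elements, and an arm of length `m` starts at the first
such sphere and moves away from the explored part. -/
theorem armEvent_subset (H : SimpleGraph V) (x : V) (m b : ℕ) :
    armEvent H x (3 * m) ⊆ {ω | ((m * (b + 1) : ℕ) : ℕ∞) ≤ (cluster H ω x).encard} ∪
      ⋃ t : {t : Σ j : ℕ, Fin (j + 1) → Finset V // IsStopped m b t.2},
        historyEvent H x t.1.2 ∩
          ⋃ y ∈ t.1.2 (Fin.last t.1.1), armEvent (avoid H (interiorOf t.1.2)) y m := by
  classical
  intro ω hω
  rw [Set.mem_union, or_iff_not_imp_left]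
  intro hsmall
  have hlt : (cluster H ω x).encard < (m * (b + 1) : ℕ) := not_le.1 hsmall
  have hfin : (cluster H ω x).Finite := Set.encard_ne_top_iff.1 hlt.ne_top
  have hS : ∀ i, (intrinsicSphere H ω x i).Finite :=
    fun i ↦ hfin.subset intrinsicSphere_subset_cluster
  let f : ℕ → Finset V := fun i ↦ (hS i).toFinset
  have hfS : ∀ i, (f i : Set V) = intrinsicSphere H ω x i := fun i ↦ (hS i).coe_toFinset
  -- Otherwise these `m` disjoint spheres of more than `b` vertices each would fill the cluster.
  have hex : ∃ j, m ≤ j ∧ j < 2 * m ∧ (f j).card ≤ b := by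
    by_contra! hcon
    have h1 : m * (b + 1) ≤ ((Finset.Ico m (2 * m)).biUnion f).card := by
      rw [Finset.card_biUnion]
      · calc m * (b + 1) = ∑ _i ∈ Finset.Ico m (2 * m), (b + 1) := by
              simp [two_mul]
          _ ≤ _ := Finset.sum_le_sum fun i hi ↦ by
              rw [Finset.mem_Ico] at hi
              exact hcon i hi.1 hi.2
      · intro i _ k _ hik
        rw [Function.onFun, ← Finset.disjoint_coe, hfS, hfS]
        exact pairwise_disjoint_intrinsicSphere hik
    have h2 : (((Finset.Ico m (2 * m)).biUnion f : Finset V) : Set V) ⊆ cluster H ω x := by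
      rw [Finset.coe_biUnion]
      refine Set.iUnion₂_subset fun i _ ↦ ?_
      rw [hfS]
      exact intrinsicSphere_subset_cluster
    have h3 := Set.encard_le_encard h2
    rw [Set.encard_coe_eq_coe_finsetCard] at h3
    exact absurd (h3.trans_lt hlt) (not_lt.2 (by exact_mod_cast h1))
  have hmin := fun n ↦ Nat.find_min hex (m := n)
  obtain ⟨hmj, hj2, hjb⟩ := Nat.find_spec hex
  set j := Nat.find hex
  obtain ⟨k, hk⟩ := Nat.exists_eq_add_of_le (show j ≤ 3 * m by omega)
  obtain ⟨z, hz⟩ := mem_armEvent.1 hω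
  rw [hk] at hz
  let s : Fin (j + 1) → Finset V := fun i ↦ f i
  have hint : ∀ v, v ∈ interiorOf s → (openGraph H ω).edist x v < j := by
    rintro v ⟨i, hi⟩
    have hv : v ∈ intrinsicSphere H ω x i := by
      rw [← hfS]; exact hi
    have hv' : (openGraph H ω).edist x v = i := hv
    rw [hv']
    exact_mod_cast i.2
  obtain ⟨y, hy, hyz⟩ := SimpleGraph.exists_edist_eq_of_edist_eq_add
    (openGraph_mono (avoid_le H (interiorOf s)) (ω := ω)) (j := j) (x := x) (by
      intro u v huv hu hv
      rw [openGraph_adj] at huv ⊢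
      exact ⟨⟨huv.1, fun h ↦ absurd (hint u h) (not_lt.2 hu),
        fun h ↦ absurd (hint v h) (not_lt.2 hv)⟩, huv.2⟩) hz
  have hys : y ∈ s (Fin.last j) := by
    have : y ∈ (f j : Set V) := by rw [hfS]; exact hy
    exact this
  refine Set.mem_iUnion.2 ⟨⟨⟨j, s⟩, hmj, fun i hi ↦ ?_, hjb, ⟨y, hys⟩⟩, fun i ↦ (hfS i).symm,
    Set.mem_iUnion₂.2 ⟨y, hys, armEvent_anti (show m ≤ k by omega) ⟨z, hyz⟩⟩⟩
  have hij : (i : ℕ) < j := i.2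
  by_contra! hc
  exact hmin i hij ⟨hi, hij.trans hj2, hc⟩

/-- The recursive inequality for the arm probability. One factor `armProb G p x m` bounds the
probability that the exploration reaches radius `m`; the other one, with the factor `b`, bounds the
conditional probability that an arm continues from the small sphere where it stops. -/
theorem armProb_three_mul_le [Countable V] (hG : IsTransitive G) (p : unitInterval) (x : V)
    (m b : ℕ) :
    armProb G p x (3 * m) ≤
      percolation G p {ω | ((m * (b + 1) : ℕ) : ℕ∞) ≤ (cluster G ω x).encard} +
        b * armProb G p x m * armProb G p x m := by
  refine armProb_le_iff.2 fun H hH ↦ ?_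
  refine (measure_mono (armEvent_subset H x m b)).trans ((measure_union_le _ _).trans
    (add_le_add (setBernoulli_le_encard_cluster_le hH p x _) ?_))
  have hB : ∀ t : {t : Σ j : ℕ, Fin (j + 1) → Finset V // IsStopped m b t.2},
      setBernoulli Set.univ p (⋃ y ∈ t.1.2 (Fin.last t.1.1),
        armEvent (avoid H (interiorOf t.1.2)) y m) ≤ b * armProb G p x m := by
    intro t
    refine (measure_biUnion_finset_le _ _).trans ?_
    refine (Finset.sum_le_card_nsmul _ _ (armProb G p x m) fun y _ ↦
      setBernoulli_armEvent_le_armProb hG ((avoid_le H _).trans hH) p x y m).trans ?_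
    rw [nsmul_eq_mul]
    gcongr
    exact t.2.2.2.1
  calc _ ≤ ∑' t : {t : Σ j : ℕ, Fin (j + 1) → Finset V // IsStopped m b t.2},
        setBernoulli Set.univ p (historyEvent H x t.1.2 ∩
          ⋃ y ∈ t.1.2 (Fin.last t.1.1), armEvent (avoid H (interiorOf t.1.2)) y m) :=
        measure_iUnion_le _
    _ ≤ ∑' t : {t : Σ j : ℕ, Fin (j + 1) → Finset V // IsStopped m b t.2},
        b * armProb G p x m * setBernoulli Set.univ p (historyEvent H x t.1.2) := by
      refine ENNReal.tsum_le_tsum fun t ↦ ?_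
      rw [setBernoulli_historyEvent_inter, mul_comm]
      gcongr
      exact hB t
    _ = b * armProb G p x m * setBernoulli Set.univ p
        (⋃ t : {t : Σ j : ℕ, Fin (j + 1) → Finset V // IsStopped m b t.2},
          historyEvent H x t.1.2) := by
      rw [ENNReal.tsum_mul_left, measure_iUnion (pairwise_disjoint_historyEvent H x m b)
        fun t ↦ measurableSet_historyEvent H x _]
    _ ≤ _ := by
      gcongr
      refine (measure_mono (Set.iUnion_subset fun t ω hω ↦ ?_)).trans
        (setBernoulli_armEvent_le_armProb_self hH p x m)
      obtain ⟨y, hy⟩ := t.2.2.2.2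
      refine armEvent_anti t.2.1 ⟨y, ?_⟩
      have := hω (Fin.last t.1.1)
      rw [Fin.val_last] at this
      rw [this]
      exact hy

end BondPercolation

/-! ### The recursion -/

namespace BondPercolation

/-- The bound `A / r` with `A = 1 + 216 * C ^ 2` propagates through the recursive inequality: the
threshold `b = ⌊m / (6 * A)⌋₊` makes the quadratic term at most half of `A / (3 * m)`, and `A` is
so large that the cluster term is at most the other half. -/
theorem recursion_bound {C : ℝ} {m : ℕ} (hC : 0 < C) (hm : 1 ≤ m) :
    C / √((m * (⌊m / (6 * (1 + 216 * C ^ 2))⌋₊ + 1) : ℕ) : ℝ) +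
      ⌊m / (6 * (1 + 216 * C ^ 2))⌋₊ * ((1 + 216 * C ^ 2) / m) * ((1 + 216 * C ^ 2) / m) ≤
    (1 + 216 * C ^ 2) / (3 * m : ℕ) := by
  set A := 1 + 216 * C ^ 2 with hA
  have hA0 : 0 < A := by positivity
  have hm0 : (0 : ℝ) < m := by exact_mod_cast hm
  have h1 : C / √((m * (⌊m / (6 * A)⌋₊ + 1) : ℕ) : ℝ) ≤ A / (6 * m) := by
    have hlt : (m : ℝ) / (6 * A) ≤ ⌊m / (6 * A)⌋₊ + 1 := (Nat.lt_floor_add_one _).le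
    have h2 : 6 * C * m / A ≤ √((m * (⌊m / (6 * A)⌋₊ + 1) : ℕ) : ℝ) := by
      apply Real.le_sqrt_of_sq_le
      push_cast
      calc (6 * C * m / A) ^ 2 = m ^ 2 / (6 * A) * (216 * C ^ 2 / A) := by field_simp; ring
        _ ≤ m ^ 2 / (6 * A) * 1 := by
          gcongr
          rw [div_le_one hA0]
          linarith
        _ = m * (m / (6 * A)) := by ring
        _ ≤ _ := by gcongr
    calc _ ≤ C / (6 * C * m / A) := by gcongr
      _ = A / (6 * m) := by field_simp
  have h2 : ⌊m / (6 * A)⌋₊ * (A / m) * (A / m) ≤ A / (6 * m) := by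
    calc _ ≤ m / (6 * A) * (A / m) * (A / m) := by
          gcongr
          exact Nat.floor_le (by positivity)
      _ = A / (6 * m) := by field_simp
  calc _ ≤ A / (6 * m) + A / (6 * m) := add_le_add h1 h2
    _ = A / (3 * m : ℕ) := by push_cast; field_simp; norm_num

theorem armProb_three_pow_le {V : Type*} [Countable V] {G : SimpleGraph V} (hG : IsTransitive G)
    {C : ℝ} (hC : 0 < C) {o : V} {p : unitInterval}
    (h : ∀ k : ℕ, 1 ≤ k → percolation G p {ω | (k : ℕ∞) ≤ (cluster G ω o).encard} ≤
      ENNReal.ofReal (C / √(k : ℝ))) (n : ℕ) :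
    armProb G p o (3 ^ n) ≤ ENNReal.ofReal ((1 + 216 * C ^ 2) / (3 ^ n : ℕ)) := by
  induction n with
  | zero =>
    refine armProb_le_one.trans ?_
    rw [ENNReal.one_le_ofReal]
    simp
    positivity
  | succ n ih =>
    have hm : 1 ≤ 3 ^ n := Nat.one_le_pow _ _ (by norm_num)
    rw [pow_succ']
    generalize 3 ^ n = m at ih hm
    set b := ⌊m / (6 * (1 + 216 * C ^ 2))⌋₊ with hb
    refine (armProb_three_mul_le hG p o m b).trans ?_
    refine le_trans ?_ (ENNReal.ofReal_le_ofReal (recursion_bound hC hm))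
    rw [← hb, ENNReal.ofReal_add (by positivity) (by positivity),
      ENNReal.ofReal_mul (by positivity), ENNReal.ofReal_mul (by positivity),
      ENNReal.ofReal_natCast]
    gcongr
    exact h _ (Nat.mul_pos hm (Nat.succ_pos b))

end BondPercolation

theorem theorem2p3 (C₁ : ℝ) (hC₁ : 0 < C₁) :
    ∃ C₂ : ℝ, 0 < C₂ ∧
      ∀ (V : Type*) [Countable V] (G : SimpleGraph V), BondPercolation.IsTransitive G →
      ∀ (o : V) (p : unitInterval),
        (∀ k : ℕ, 1 ≤ k →
          BondPercolation.percolation G p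
            {ω | (k : ℕ∞) ≤ (BondPercolation.cluster G ω o).encard} ≤
              ENNReal.ofReal (C₁ / Real.sqrt (k : ℝ))) →
        ∀ r : ℕ, 1 ≤ r →
          BondPercolation.armProb G p o r ≤ ENNReal.ofReal (C₂ / (r : ℝ)) := by
  refine ⟨3 * (1 + 216 * C₁ ^ 2), by positivity, fun V _ G hG o p h r hr ↦ ?_⟩
  have h1 : 3 ^ Nat.log 3 r ≤ r := Nat.pow_log_le_self 3 (by omega)
  have h2 : r < 3 ^ (Nat.log 3 r + 1) := Nat.lt_pow_succ_log_self (by norm_num) r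
  refine (BondPercolation.armProb_anti h1).trans
    ((BondPercolation.armProb_three_pow_le hG hC₁ h _).trans (ENNReal.ofReal_le_ofReal ?_))
  have h3 : (r : ℝ) ≤ 3 * (3 ^ Nat.log 3 r : ℕ) := by
    rw [pow_succ'] at h2
    exact_mod_cast h2.le
  have hr0 : (0 : ℝ) < r := by exact_mod_cast hr
  calc _ = 3 * (1 + 216 * C₁ ^ 2) / (3 * (3 ^ Nat.log 3 r : ℕ)) := by
        push_cast; field_simp
    _ ≤ _ := by gcongr
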